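/- Let $\mathbb{L}$ be the set of Liouville numbers, i.e. of the irrational real numbers $x$ such that for every $n\in\mathbb{N}$ there is an integer $q\ge 2$ with $\|qx\|<q^{-n}$, where $\|y\|=\min_{m\in\mathbb{Z}}|y-m|$. For a Borel probability measure $\mu$ on $\mathbb{R}$ let $\hat\mu(\xi)=\int_{\mathbb{R}} e^{-2\pi i\xi x}\,d\mu(x)$, and for $f:\mathbb{R}_{\ge0}\to\mathbb{R}_{\ge0}$ write $\hat\mu=O(f)$ if there are $M>0$ and $c>0$ such that $|\hat\mu(\xi)|\le c\,f(|\xi|)$ for all real $\xi$ with $|\xi|\ge M$. Let $f:\mathbb{R}_{\ge0}\to\mathbb{R}_{\ge0}$ be a bounded function that is either decreasing (not necessarily strictly) or continuous. In the following, for $\xi>0$, the quotient $\xi^{-\alpha}/f(\xi)$ is taken in $[0,\infty]$, with value $+\infty$ if $f(\xi)=0$. Then: (i) If $\displaystyle\limsup_{\xi\to+\infty}\frac{\xi^{-\alpha}}{f(\xi)}=0$ for every $\alpha>0$, then there is a Borel probability measure $\mu$ on $\mathbb{R}$ with $\mu(\mathbb{R}\setminus\mathbb{L})=0$ and $\hat\mu=O(f)$.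 (ii) If $\displaystyle\liminf_{\xi\to+\infty}\frac{\xi^{-\alpha_0}}{f(\xi)}>0$ for some $\alpha_0>0$, then there is no Borel probability measure $\mu$ on $\mathbb{R}$ with $\mu(\mathbb{R}\setminus\mathbb{L})=0$ and $\hat\mu=O(f)$. -/

import Mathlib

open Filter MeasureTheory
open scoped NNReal ENNReal

/-- The set `𝕃` of Liouville numbers, as a subset of the real line. -/
def liouvilleSet : Set ℝ := {x | Liouville x}

/-- The Fourier transform `μ̂(ξ) = ∫ e^{-2πi ξ x} dμ(x)` of a measure `μ` on the real line. -/
noncomputable def fourierTransformMeasure (μ : Measure ℝ) (ξ : ℝ) : ℂ :=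
  ∫ x : ℝ, Complex.exp (-2 * (Real.pi : ℂ) * Complex.I * (ξ : ℂ) * (x : ℂ)) ∂μ

/-- `μ̂ = O(f)` at infinity: there are `M > 0` and `c > 0` with `|μ̂(ξ)| ≤ c f(|ξ|)` whenever
`|ξ| ≥ M`. -/
def HasFourierDecay (μ : Measure ℝ) (f : ℝ≥0 → ℝ≥0) : Prop :=
  ∃ M : ℝ, 0 < M ∧ ∃ c : ℝ, 0 < c ∧
    ∀ ξ : ℝ, M ≤ |ξ| → ‖fourierTransformMeasure μ ξ‖ ≤ c * (f (Real.nnabs ξ) : ℝ)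

/-- The Fourier set of `E ⊆ ℝ`: the functions `f : [0, ∞) → [0, ∞)` for which some Borel
probability measure `μ` on `E` (that is, with `μ (ℝ ∖ E) = 0`) satisfies `μ̂ = O(f)`.
Membership depends only on the class of `f` under mutual domination at infinity. -/
def fourierSet (E : Set ℝ) : Set (ℝ≥0 → ℝ≥0) :=
  {f | ∃ μ : Measure ℝ, IsProbabilityMeasure μ ∧ μ Eᶜ = 0 ∧ HasFourierDecay μ f}

/-- The quotient `ξ^{-α} / f(ξ)` as an extended nonnegative number; for `ξ > 0` it is `∞` exactly
when `f(ξ) = 0`. -/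
noncomputable def powerRatio (f : ℝ≥0 → ℝ≥0) (α : ℝ) (ξ : ℝ≥0) : ℝ≥0∞ :=
  (ξ : ℝ≥0∞) ^ (-α) / (f ξ : ℝ≥0∞)

/-! Both halves rest on `integral_fejerKernel_mul_exp`: weighting μ by the Fejér kernel F_N(Tx),
which concentrates near T⁻¹ℤ, averages translates of μ̂ by multiples of T.

(ii) If μ̂ decays polynomially, only the diagonal terms of this average are large, so the part of ℝ
within about 1/(NT) of T⁻¹ℤ has mass O(1/N + ε), where ε bounds |μ̂| beyond T. With T = q^s and N =
q², points extremely close to some a/q have mass O(q⁻²), and Borel–Cantelli shows that Liouville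
numbers are not charged (`measure_setOf_liouville_eq_zero`).

(i) Start from a probability measure with compactly supported transform and multiply repeatedly by
averages of F_N(px) over the primes p in (M, M³] (`exists_weight`). If μ̂ lives on [-R, R] and p >
2R, then μ̂ is unchanged there. A new frequency ξ sees only the at most 2R + 1 integers within R of
it, each divisible by at most c of the at least M primes, where |ξ| ≤ M^c and c is fixed before M.
So the new transform is O(1/M), which is below |ξ|^(-1/(2c)) ≤ f(|ξ|) for large M. Each frequency is
eventually frozen, so a weak limit ν exists with ν̂ = O(f). The set where the j-th weight is below
2^(-j) has ν-mass at most 2^(-j), because later weights preserve the mass of every band-limited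
probability measure. Borel–Cantelli gives ν-almost every point rational approximations of every
order, and ν̂ → 0 rules out atoms at rationals. -/

/-! ### Fejér kernels integrated against a measure. -/

/-- The Fejér kernel `(1/N) |∑_{j<N} e^{2πi j y}|²`. -/
noncomputable def fejerKernel (N : ℕ) (y : ℝ) : ℝ :=
  ‖∑ j ∈ Finset.range N, Complex.exp (2 * Real.pi * Complex.I * (j * y : ℝ))‖ ^ 2 / N

lemma fejerKernel_nonneg (N : ℕ) (y : ℝ) : 0 ≤ fejerKernel N y := by
  unfold fejerKernel; positivity

@[fun_prop]
lemma continuous_fejerKernel (N : ℕ) : Continuous (fejerKernel N) := by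
  unfold fejerKernel; fun_prop

lemma norm_exp_two_pi_I_mul (t : ℝ) : ‖Complex.exp (2 * Real.pi * Complex.I * (t : ℂ))‖ = 1 := by
  rw [show (2 * Real.pi * Complex.I * (t : ℂ) : ℂ) = ((2 * Real.pi * t : ℝ) : ℂ) * Complex.I by
    push_cast; ring]
  exact Complex.norm_exp_ofReal_mul_I _

lemma fejerKernel_le (N : ℕ) (y : ℝ) : fejerKernel N y ≤ N := by
  unfold fejerKernel
  have h : ‖∑ j ∈ Finset.range N, Complex.exp (2 * Real.pi * Complex.I * (j * y : ℝ))‖ ≤ N := by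
    refine (norm_sum_le _ _).trans ?_
    simp [norm_exp_two_pi_I_mul, -Complex.ofReal_mul]
  rcases Nat.eq_zero_or_pos N with rfl | hN
  · simp
  · rw [div_le_iff₀ (by positivity), ← sq]
    gcongr

lemma ofReal_fejerKernel (N : ℕ) (y : ℝ) :
    (fejerKernel N y : ℂ) = (1 / N : ℂ) * ∑ j ∈ Finset.range N, ∑ l ∈ Finset.range N,
      Complex.exp (2 * Real.pi * Complex.I * (((j : ℝ) - (l : ℝ)) * y : ℝ)) := by
  unfold fejerKernel
  push_cast
  rw [← Complex.mul_conj', map_sum, Finset.sum_mul_sum, div_eq_inv_mul, one_div]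
  congr 1
  refine Finset.sum_congr rfl fun j _ => Finset.sum_congr rfl fun l _ => ?_
  rw [← Complex.exp_conj, ← Complex.exp_add]
  congr 1
  simp [map_ofNat]
  ring

lemma norm_fourierTransformMeasure_le (μ : Measure ℝ) [IsProbabilityMeasure μ] (ξ : ℝ) :
    ‖fourierTransformMeasure μ ξ‖ ≤ 1 := by
  unfold fourierTransformMeasure
  refine (norm_integral_le_of_norm_le_const (C := 1) (ae_of_all _ fun x => ?_)).trans (by simp)
  have := norm_exp_two_pi_I_mul (-(ξ * x))
  refine le_of_eq (Eq.trans ?_ this)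
  congr 2; push_cast; ring

lemma fourierTransformMeasure_zero (μ : Measure ℝ) :
    fourierTransformMeasure μ 0 = (μ.real Set.univ : ℂ) := by
  simp [fourierTransformMeasure]

lemma integrable_exp_fourier (μ : Measure ℝ) [IsFiniteMeasure μ] (ξ : ℝ) :
    Integrable (fun x : ℝ => Complex.exp (-2 * (Real.pi : ℂ) * Complex.I * (ξ : ℂ) * (x : ℂ))) μ := by
  refine Integrable.of_bound (C := 1) (by fun_prop) (ae_of_all _ fun x => ?_)
  have := norm_exp_two_pi_I_mul (-(ξ * x))
  refine le_of_eq (Eq.trans ?_ this)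
  congr 2; push_cast; ring

lemma integral_fejerKernel_mul_exp (μ : Measure ℝ) [IsFiniteMeasure μ] (N : ℕ) (T ξ : ℝ) :
    ∫ x : ℝ, (fejerKernel N (T * x) : ℂ) *
      Complex.exp (-2 * (Real.pi : ℂ) * Complex.I * (ξ : ℂ) * (x : ℂ)) ∂μ =
    (1 / N : ℂ) * ∑ j ∈ Finset.range N, ∑ l ∈ Finset.range N,
      fourierTransformMeasure μ (ξ - ((j : ℝ) - (l : ℝ)) * T) := by
  simp_rw [ofReal_fejerKernel, mul_assoc (1 / N : ℂ), integral_const_mul, Finset.sum_mul]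
  congr 1
  have key : ∀ (j l : ℕ) (x : ℝ),
      Complex.exp (2 * Real.pi * Complex.I * (((j : ℝ) - (l : ℝ)) * (T * x) : ℝ)) *
        Complex.exp (-2 * (Real.pi : ℂ) * Complex.I * (ξ : ℂ) * (x : ℂ)) =
      Complex.exp (-2 * (Real.pi : ℂ) * Complex.I *
        ((ξ - ((j : ℝ) - (l : ℝ)) * T : ℝ) : ℂ) * (x : ℂ)) := by
    intro j l x
    rw [← Complex.exp_add]; congr 1; push_cast; ring
  simp_rw [key]
  rw [integral_finsetSum _ fun j _ => integrable_finsetSum _ fun l _ =>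
    integrable_exp_fourier μ _]
  refine Finset.sum_congr rfl fun j _ => ?_
  rw [integral_finsetSum _ fun l _ => integrable_exp_fourier μ _]
  rfl

lemma norm_exp_two_pi_I_mul_sub_one_le (t : ℝ) (a : ℤ) :
    ‖Complex.exp (2 * Real.pi * Complex.I * (t : ℂ)) - 1‖ ≤ 2 * Real.pi * |t - a| := by
  have h : Complex.exp (2 * Real.pi * Complex.I * (t : ℂ)) =
      Complex.exp (Complex.I * ((2 * Real.pi * (t - a) : ℝ) : ℂ)) := by
    rw [show (2 * Real.pi * Complex.I * (t : ℂ) : ℂ) =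
      Complex.I * ((2 * Real.pi * (t - a) : ℝ) : ℂ) + a * (2 * Real.pi * Complex.I) by
        push_cast; ring, Complex.exp_periodic.int_mul a]
  rw [h]
  refine (Real.norm_exp_I_mul_ofReal_sub_one_le).trans ?_
  rw [Real.norm_eq_abs, abs_mul, abs_of_pos (by positivity : 0 < 2 * Real.pi)]

lemma le_fejerKernel_of_near_int (N : ℕ) (y : ℝ) (a : ℤ) (h : |y - a| ≤ 1 / (16 * N)) :
    (N / 4 : ℝ) ≤ fejerKernel N y := by
  rcases Nat.eq_zero_or_pos N with rfl | hN
  · simp [fejerKernel]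
  have hN' : (0 : ℝ) < N := by positivity
  set S := ∑ j ∈ Finset.range N, Complex.exp (2 * Real.pi * Complex.I * (j * y : ℝ)) with hS
  have h1 : ‖S - N‖ ≤ N / 2 := by
    have : S - N = ∑ j ∈ Finset.range N,
        (Complex.exp (2 * Real.pi * Complex.I * (j * y : ℝ)) - 1) := by
      rw [hS, Finset.sum_sub_distrib]; simp
    rw [this]
    refine (norm_sum_le _ _).trans ?_
    refine (Finset.sum_le_sum (g := fun _ => (1 / 2 : ℝ)) fun j hj => ?_).trans (by simp; linarith)
    refine (norm_exp_two_pi_I_mul_sub_one_le _ (j * a)).trans ?_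
    have hj' : (j : ℝ) ≤ N := by exact_mod_cast (Finset.mem_range.1 hj).le
    have h2 : |(j : ℝ) * y - ((j * a : ℤ) : ℝ)| ≤ N * (1 / (16 * N)) := by
      push_cast
      rw [← mul_sub, abs_mul, Nat.abs_cast]
      gcongr
    have h3 : (N : ℝ) * (1 / (16 * N)) = 1 / 16 := by field_simp
    rw [h3] at h2
    -- The constant 16 makes every phase error at most 2π/16 < 1/2.
    nlinarith [Real.pi_lt_four, Real.pi_pos]
  have h2 : (N / 2 : ℝ) ≤ ‖S‖ := by
    have := norm_sub_norm_le (N : ℂ) S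
    rw [norm_sub_rev, Complex.norm_natCast] at this
    linarith
  unfold fejerKernel
  rw [← hS, le_div_iff₀ hN']
  nlinarith

lemma integrable_fejerKernel (μ : Measure ℝ) [IsFiniteMeasure μ] (N : ℕ) (T : ℝ) :
    Integrable (fun x => fejerKernel N (T * x)) μ := by
  refine Integrable.of_bound (C := N)
    ((continuous_fejerKernel N).comp (by fun_prop)).aestronglyMeasurable (ae_of_all _ fun x => ?_)
  rw [Real.norm_of_nonneg (fejerKernel_nonneg _ _)]
  exact fejerKernel_le _ _

/-- In the double sum over (j, l) the N diagonal terms contribute 1 after normalisation; every other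
term samples μ̂ at a nonzero multiple of T. -/
lemma integral_fejerKernel_le (μ : Measure ℝ) [IsProbabilityMeasure μ] (N : ℕ) {T ε : ℝ}
    (hT : 0 < T) (hε : 0 ≤ ε) (h : ∀ ξ : ℝ, T ≤ |ξ| → ‖fourierTransformMeasure μ ξ‖ ≤ ε) :
    ∫ x, fejerKernel N (T * x) ∂μ ≤ 1 + N * ε := by
  have h0 := integral_fejerKernel_mul_exp μ N T 0
  simp only [Complex.ofReal_zero, mul_zero, zero_mul, Complex.exp_zero, mul_one] at h0
  rw [integral_complex_ofReal] at h0
  have h1 : ∫ x, fejerKernel N (T * x) ∂μ ≤ ‖((∫ x, fejerKernel N (T * x) ∂μ : ℝ) : ℂ)‖ := by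
    rw [Complex.norm_real]; exact le_abs_self _
  refine h1.trans ?_
  rw [h0, norm_mul]
  have h2 : ‖∑ j ∈ Finset.range N, ∑ l ∈ Finset.range N,
      fourierTransformMeasure μ (0 - ((j : ℝ) - (l : ℝ)) * T)‖ ≤ N * (1 + N * ε) := by
    refine (norm_sum_le _ _).trans ?_
    refine (Finset.sum_le_sum (g := fun _ => (1 + N * ε : ℝ)) fun j hj => ?_).trans (by simp [mul_add])
    refine (norm_sum_le _ _).trans ?_
    refine (Finset.sum_le_sum (g := fun l => ((if l = j then 1 else 0) + ε : ℝ))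
      fun l _ => ?_).trans (by simp [Finset.sum_add_distrib, Finset.mem_range.1 hj])
    split_ifs with hl
    · exact (norm_fourierTransformMeasure_le μ _).trans (by linarith)
    · rw [zero_add]
      refine h _ ?_
      rw [zero_sub, abs_neg, abs_mul, abs_of_pos hT]
      have : (1 : ℝ) ≤ |(j : ℝ) - l| := by
        have : (1 : ℤ) ≤ |(j : ℤ) - l| := Int.one_le_abs (by omega)
        exact_mod_cast this
      nlinarith
  rcases Nat.eq_zero_or_pos N with rfl | hN
  · simp
  have hN' : (0 : ℝ) < N := by positivity
  calc _ ≤ ‖(1 / N : ℂ)‖ * (N * (1 + N * ε)) := by gcongr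
    _ = 1 + N * ε := by simp; field_simp

/-! ### Mass near lattices, and part (ii). -/

/-- A measure whose Fourier transform is small beyond `T` gives small mass to the neighbourhood of
the lattice `T⁻¹ ℤ`. -/
lemma measureReal_near_lattice_le (μ : Measure ℝ) [IsProbabilityMeasure μ] {N : ℕ} (hN : 0 < N)
    {T ε : ℝ} (hT : 0 < T) (hε : 0 ≤ ε)
    (h : ∀ ξ : ℝ, T ≤ |ξ| → ‖fourierTransformMeasure μ ξ‖ ≤ ε) :
    μ.real {x | ∃ a : ℤ, |T * x - a| ≤ 1 / (16 * N)} ≤ 4 * (1 / N + ε) := by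
  have hN' : (0 : ℝ) < N := by positivity
  have h1 := mul_meas_ge_le_integral_of_nonneg (μ := μ)
    (ae_of_all _ fun x => fejerKernel_nonneg N (T * x)) (integrable_fejerKernel μ N T) (N / 4)
  have h2 : μ.real {x | ∃ a : ℤ, |T * x - a| ≤ 1 / (16 * N)} ≤
      μ.real {x | (N / 4 : ℝ) ≤ fejerKernel N (T * x)} :=
    measureReal_mono fun x ⟨a, ha⟩ => le_fejerKernel_of_near_int N _ a ha
  have h3 := h1.trans (integral_fejerKernel_le μ N hT hε h)
  refine h2.trans ?_
  rw [show (4 * (1 / N + ε) : ℝ) = (1 + N * ε) / (N / 4) by field_simp, le_div_iff₀ (by positivity),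
    mul_comm]
  exact h3

/-- The point r lies on T⁻¹ℤ for every multiple T of its denominator, so T can be taken beyond the
range where μ̂ is large. -/
lemma measure_singleton_eq_zero_of_rational (μ : Measure ℝ) [IsProbabilityMeasure μ]
    (h : ∀ ε : ℝ, 0 < ε → ∃ T : ℝ, ∀ ξ : ℝ, T ≤ |ξ| → ‖fourierTransformMeasure μ ξ‖ ≤ ε) (r : ℚ) :
    μ {(r : ℝ)} = 0 := by
  rw [← measureReal_eq_zero_iff]
  refine le_antisymm (le_of_forall_pos_le_add fun η hη => ?_) measureReal_nonneg
  obtain ⟨T, hT⟩ := h (η / 8) (by positivity)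
  obtain ⟨t, ht⟩ := exists_nat_gt T
  obtain ⟨N, hN⟩ := exists_nat_gt (8 / η)
  have hNr : (0 : ℝ) < N := lt_trans (by positivity) hN
  have hN0 : 0 < N := by exact_mod_cast hNr
  have hd : (1 : ℝ) ≤ r.den := by exact_mod_cast r.pos
  have := measureReal_near_lattice_le μ hN0 (T := r.den * ((t : ℝ) + 1)) (ε := η / 8)
    (by positivity) (by positivity)
    (fun ξ hξ => hT ξ (by nlinarith [Nat.cast_nonneg (α := ℝ) t]))
  have h1 : μ.real {(r : ℝ)} ≤ μ.real {x | ∃ a : ℤ, |r.den * ((t : ℝ) + 1) * x - a| ≤ 1 / (16 * N)} := by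
    refine measureReal_mono ?_
    rintro x rfl
    refine ⟨r.num * (t + 1), ?_⟩
    have : (r.den : ℝ) * r = r.num := by
      have := Rat.den_mul_eq_num r
      exact_mod_cast this
    have h0 : (r.den : ℝ) * ((t : ℝ) + 1) * r - ((r.num * (t + 1) : ℤ) : ℝ) = 0 := by
      push_cast; rw [← this]; ring
    rw [h0]; simp
  have h2 : 1 / (N : ℝ) ≤ η / 8 := by
    rw [div_le_iff₀ hNr]; rw [div_lt_iff₀ hη] at hN; linarith
  linarith

/-- A probability measure whose Fourier transform decays polynomially does not charge the set of
Liouville numbers. -/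
lemma measure_setOf_liouville_eq_zero (μ : Measure ℝ) [IsProbabilityMeasure μ] {α C M : ℝ}
    (hα : 0 < α) (hC : 0 ≤ C)
    (h : ∀ ξ : ℝ, M ≤ |ξ| → ‖fourierTransformMeasure μ ξ‖ ≤ C * |ξ| ^ (-α)) :
    μ {x | Liouville x} = 0 := by
  -- Frequencies beyond q^s then have transform O(q^(-sα)), hence O(q⁻²).
  obtain ⟨s, hs⟩ := exists_nat_gt (2 / α)
  have hsα : 2 ≤ s * α := by rw [div_lt_iff₀ hα] at hs; exact hs.le
  have hs1 : 1 ≤ s := by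
    have : (0 : ℝ) < s := lt_trans (by positivity) hs
    exact_mod_cast this
  obtain ⟨q₀, hq₀⟩ := exists_nat_gt M
  -- After scaling by q^s the exponent s + 6 leaves q⁻⁶ ≤ 1/(16 q²) for q ≥ 2: exactly the lattice
  -- neighbourhood for N = q².
  let E : ℕ → Set ℝ := fun q =>
    {x | q₀ + 2 ≤ q ∧ ∃ a : ℤ, |x - a / q| < 1 / (q : ℝ) ^ (s + 6)}
  have hE : ∀ q : ℕ, μ.real (E q) ≤ 4 * (1 + C) * (1 / (q : ℝ) ^ 2) := by
    intro q
    by_cases hq : q₀ + 2 ≤ q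
    swap
    · have : E q = ∅ := by
        ext x; simp only [E, hq, false_and, Set.mem_ofPred_eq, Set.mem_empty_iff_false]
      rw [this]; simp; positivity
    have hq2 : (2 : ℝ) ≤ q := by
      have : 2 ≤ q := by omega
      exact_mod_cast this
    have hq0 : (0 : ℝ) < q := by linarith
    have hqM : M ≤ (q : ℝ) ^ s := by
      have : (q₀ : ℝ) ≤ q := by
        have : q₀ ≤ q := by omega
        exact_mod_cast this
      have h2 : (q : ℝ) ≤ q ^ s := le_self_pow₀ (by linarith) (by omega)
      linarith
    have hdecay : ∀ ξ : ℝ, (q : ℝ) ^ s ≤ |ξ| →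
        ‖fourierTransformMeasure μ ξ‖ ≤ C * (1 / (q : ℝ) ^ 2) := by
      intro ξ hξ
      refine (h ξ (hqM.trans hξ)).trans ?_
      gcongr
      calc |ξ| ^ (-α) ≤ ((q : ℝ) ^ s) ^ (-α) :=
            Real.rpow_le_rpow_of_nonpos (by positivity) hξ (by linarith)
        _ = (q : ℝ) ^ (-(s * α)) := by
            rw [← Real.rpow_natCast, ← Real.rpow_mul hq0.le]; congr 1; ring
        _ ≤ (q : ℝ) ^ (-2 : ℝ) := Real.rpow_le_rpow_of_exponent_le (by linarith) (by linarith)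
        _ = 1 / (q : ℝ) ^ 2 := by
            rw [Real.rpow_neg hq0.le, one_div]; norm_num
    have hA := measureReal_near_lattice_le μ (N := q ^ 2) (pow_pos (by omega) 2) (T := (q : ℝ) ^ s)
      (by positivity) (by positivity) hdecay
    refine (measureReal_mono ?_).trans (hA.trans (le_of_eq ?_))
    · rintro x ⟨-, a, ha⟩
      refine ⟨a * q ^ (s - 1), ?_⟩
      have h1 : (q : ℝ) ^ s * x - ((a * q ^ (s - 1) : ℤ) : ℝ) = q ^ s * (x - a / q) := by
        obtain ⟨t, rfl⟩ : ∃ t, s = t + 1 := ⟨s - 1, by omega⟩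
        push_cast
        field_simp
        ring
      rw [h1, abs_mul, abs_of_pos (by positivity)]
      calc (q : ℝ) ^ s * |x - a / q| ≤ q ^ s * (1 / (q : ℝ) ^ (s + 6)) := by gcongr
        _ = 1 / (q ^ 4 * q ^ 2) := by rw [pow_add]; field_simp
        _ ≤ 1 / (16 * ((q ^ 2 : ℕ) : ℝ)) := by
            push_cast
            have : (16 : ℝ) ≤ q ^ 4 := by
              calc (16 : ℝ) = 2 ^ 4 := by norm_num
                _ ≤ q ^ 4 := by gcongr
            gcongr
    · push_cast; ring
  have hsum : ∑' q, μ (E q) ≠ ∞ := by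
    have h1 : Summable fun q : ℕ => 4 * (1 + C) * (1 / (q : ℝ) ^ 2) :=
      (Real.summable_one_div_nat_pow.2 one_lt_two).mul_left _
    have h2 : ∀ q, μ (E q) ≤ ENNReal.ofReal (4 * (1 + C) * (1 / (q : ℝ) ^ 2)) := fun q => by
      rw [← ofReal_measureReal]; exact ENNReal.ofReal_le_ofReal (hE q)
    exact ne_top_of_le_ne_top h1.tsum_ofReal_ne_top (ENNReal.tsum_le_tsum h2)
  have hae := ae_eventually_notMem hsum
  have hsub : {x | Liouville x} ⊆ {x | ¬ ∀ᶠ q in atTop, x ∉ E q} := by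
    intro x hx hev
    obtain ⟨q, ⟨a, -, ha⟩, hq, hq2⟩ :=
      ((hx.frequently_exists_num (s + 6)).and_eventually
        (hev.and (eventually_ge_atTop (q₀ + 2)))).exists
    exact hq ⟨hq2, a, ha⟩
  exact measure_mono_null hsub hae

lemma not_mem_fourierSet_of_liminf_pos {f : ℝ≥0 → ℝ≥0} {α : ℝ} (hα : 0 < α)
    (h : 0 < liminf (powerRatio f α) atTop) : f ∉ fourierSet liouvilleSet := by
  rintro ⟨μ, hμ, hμL, M, hM, c, hc, hdecay⟩
  obtain ⟨ε, hε0, hε⟩ := ENNReal.lt_iff_exists_nnreal_btwn.1 h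
  have hε0 : 0 < ε := by exact_mod_cast hε0
  have hev := eventually_lt_of_lt_liminf hε
  obtain ⟨X, hX⟩ := eventually_atTop.1 (hev.and (eventually_gt_atTop 0))
  have hzero : μ {x | Liouville x} = 0 := by
    refine measure_setOf_liouville_eq_zero μ (α := α) (C := c / ε) (M := max M X) hα
      (by positivity) fun ξ hξ => ?_
    refine (hdecay ξ ((le_max_left _ _).trans hξ)).trans ?_
    have hX' : X ≤ Real.nnabs ξ := by
      rw [← NNReal.coe_le_coe, Real.coe_nnabs]; exact (le_max_right _ _).trans hξ
    obtain ⟨h1, h2⟩ := hX _ hX'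
    have h3 : ε * f (Real.nnabs ξ) ≤ (Real.nnabs ξ) ^ (-α) := by
      have h4 : (ε : ℝ≥0∞) * f (Real.nnabs ξ) ≤ (Real.nnabs ξ : ℝ≥0∞) ^ (-α) :=
        ENNReal.mul_le_of_le_div h1.le
      rw [← ENNReal.coe_rpow_of_ne_zero h2.ne'] at h4
      exact_mod_cast h4
    have h5 : (ε : ℝ) * f (Real.nnabs ξ) ≤ |ξ| ^ (-α) := by
      have := NNReal.coe_le_coe.2 h3
      push_cast at this
      simpa using this
    rw [div_mul_eq_mul_div, le_div_iff₀ (by exact_mod_cast hε0)]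
    nlinarith
  have h1 : μ Set.univ = 0 := by
    rw [← Set.union_compl_self liouvilleSet]
    exact measure_union_null hzero hμL
  simp at h1

lemma eventually_rpow_le_of_limsup_eq_zero {f : ℝ≥0 → ℝ≥0} {α : ℝ}
    (h : limsup (powerRatio f α) atTop = 0) : ∀ᶠ ξ : ℝ≥0 in atTop, ξ ^ (-α) ≤ f ξ := by
  have h1 : limsup (powerRatio f α) atTop < 1 := by rw [h]; exact one_pos
  filter_upwards [eventually_lt_of_limsup_lt h1, eventually_gt_atTop 0] with ξ hξ h0
  have h2 : (ξ : ℝ≥0∞) ^ (-α) ≤ f ξ := by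
    by_contra! h3
    have h5 : (ξ : ℝ≥0∞) ^ (-α) ≤ (ξ : ℝ≥0∞) ^ (-α) / f ξ * f ξ := by
      by_cases hf : (f ξ : ℝ≥0∞) = 0
      · unfold powerRatio at hξ
        rw [hf, ENNReal.div_zero (ne_of_gt (by simpa [hf] using h3))] at hξ
        simp at hξ
      · rw [ENNReal.div_mul_cancel hf ENNReal.coe_ne_top]
    have h6 : (ξ : ℝ≥0∞) ^ (-α) / f ξ * f ξ ≤ 1 * f ξ := by gcongr; exact hξ.le
    exact absurd (h5.trans h6) (by simpa using h3)
  rw [← ENNReal.coe_rpow_of_ne_zero h0.ne'] at h2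
  exact_mod_cast h2

/-! ### A band-limited probability measure to start from. -/

open scoped SchwartzMap FourierTransform Convolution

/-- A probability measure whose Fourier transform vanishes outside `[-R, R]`. -/
structure BandLimited (μ : Measure ℝ) (R : ℝ) : Prop where
  prob : IsProbabilityMeasure μ
  eq_zero : ∀ ξ : ℝ, R < |ξ| → fourierTransformMeasure μ ξ = 0

lemma fourierTransformMeasure_withDensity (μ : Measure ℝ) {g : ℝ → ℝ} (hg : Continuous g)
    (hg0 : ∀ x, 0 ≤ g x) (ξ : ℝ) :
    fourierTransformMeasure (μ.withDensity fun x => ENNReal.ofReal (g x)) ξ =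
      ∫ x : ℝ, (g x : ℂ) *
        Complex.exp (-2 * (Real.pi : ℂ) * Complex.I * (ξ : ℂ) * (x : ℂ)) ∂μ := by
  unfold fourierTransformMeasure
  rw [integral_withDensity_eq_integral_toReal_smul (by fun_prop) (by simp)]
  simp [ENNReal.toReal_ofReal (hg0 _)]

lemma fourierTransformMeasure_smul (μ : Measure ℝ) (c : ℝ≥0∞) (ξ : ℝ) :
    fourierTransformMeasure (c • μ) ξ = c.toReal * fourierTransformMeasure μ ξ := by
  simp [fourierTransformMeasure, integral_smul_measure]

lemma fourier_real_of_even (u : ℝ → ℝ) (hu : ∀ x, u (-x) = u x) (x : ℝ) :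
    (starRingEnd ℂ) (𝓕 (fun t => (u t : ℂ)) x) = 𝓕 (fun t => (u t : ℂ)) x := by
  rw [Real.fourier_real_eq_integral_exp_smul, ← integral_conj]
  rw [← integral_neg_eq_self]
  congr 1 with v
  simp only [smul_eq_mul, map_mul, Complex.conj_ofReal, hu, ← Complex.exp_conj]
  congr 2
  simp

/-- Take as density the square of the Fourier transform of an even real bump φ supported in [-1/2,
1/2]. That transform is real, so the density is nonnegative, and the measure's transform is a
multiple of φ ⋆ φ, supported in [-1, 1]. -/
lemma exists_bandLimited : ∃ μ : Measure ℝ, BandLimited μ 1 := by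
  let φ : ContDiffBump (0 : ℝ) := ⟨1 / 4, 1 / 2, by norm_num, by norm_num⟩
  have hsupp : HasCompactSupport (fun x => (φ x : ℂ)) :=
    φ.hasCompactSupport.comp_left (g := fun t : ℝ => (t : ℂ)) (by simp)
  have hdiff : ContDiff ℝ ((⊤ : ℕ∞) : WithTop ℕ∞) (fun x => (φ x : ℂ)) :=
    Complex.ofRealCLM.contDiff.comp φ.contDiff
  let s : 𝓢(ℝ, ℂ) := hsupp.toSchwartzMap hdiff
  have hs : ∀ x, s x = φ x := fun x => rfl
  have hscoe : (s : ℝ → ℂ) = fun x => (φ x : ℂ) := rfl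
  let w : 𝓢(ℝ, ℂ) := SchwartzMap.convolution (ContinuousLinearMap.mul ℂ ℂ) s s
  let g : ℝ → ℝ := fun x => ((𝓕 s) x).re ^ 2
  have hreal : ∀ x, (((𝓕 s) x).re : ℂ) = (𝓕 s) x := by
    intro x
    rw [← Complex.conj_eq_iff_re, SchwartzMap.fourier_coe, hscoe]
    exact fourier_real_of_even _ (fun x => φ.neg x) x
  have hgw : ∀ x, (g x : ℂ) = (𝓕 w) x := by
    intro x
    simp only [w, SchwartzMap.fourier_convolution, SchwartzMap.pairing_apply_apply, g]
    push_cast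
    rw [hreal]
    simp [sq]
  have hgcont : Continuous g := (Complex.continuous_re.comp (𝓕 s).continuous).pow 2
  have hg0 : ∀ x, 0 ≤ g x := fun x => sq_nonneg _
  have hgint : Integrable g := by
    have h1 : Integrable (𝓕 w : 𝓢(ℝ, ℂ)) := (𝓕 w : 𝓢(ℝ, ℂ)).integrable
    have h2 := h1.re
    refine h2.congr (ae_of_all _ fun x => ?_)
    simp [← hgw]
  let m : Measure ℝ := volume.withDensity fun x => ENNReal.ofReal (g x)
  have hmfin : IsFiniteMeasure m := isFiniteMeasure_withDensity_ofReal hgint.2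
  have hft : ∀ ξ, fourierTransformMeasure m ξ = w (-ξ) := by
    intro ξ
    rw [fourierTransformMeasure_withDensity _ hgcont hg0]
    have h1 : w (-ξ) = 𝓕⁻ (𝓕 (w : ℝ → ℂ)) (-ξ) := by
      rw [← SchwartzMap.fourier_coe, ← SchwartzMap.fourierInv_coe]; simp
    rw [h1, Real.fourierInv_eq_fourier_neg, neg_neg, Real.fourier_real_eq_integral_exp_smul]
    congr 1 with x
    rw [hgw, smul_eq_mul, mul_comm, SchwartzMap.fourier_coe]
    congr 2
    push_cast; ring
  have hw : ∀ x : ℝ, 1 < |x| → w x = 0 := by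
    intro x hx
    rw [show w x = (s ⋆[ContinuousLinearMap.mul ℂ ℂ] s) x from SchwartzMap.convolution_apply _ _ _ _]
    unfold MeasureTheory.convolution
    refine integral_eq_zero_of_ae (ae_of_all _ fun t => ?_)
    simp only [ContinuousLinearMap.mul_apply', hs, Pi.zero_apply, mul_eq_zero,
      Complex.ofReal_eq_zero]
    by_contra! hne
    have h1 : t ∈ Metric.ball (0 : ℝ) (1 / 2) := by
      have : t ∈ Function.support φ := hne.1
      rwa [φ.support_eq] at this
    have h2 : x - t ∈ Metric.ball (0 : ℝ) (1 / 2) := by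
      have : x - t ∈ Function.support φ := hne.2
      rwa [φ.support_eq] at this
    rw [mem_ball_zero_iff, Real.norm_eq_abs] at h1 h2
    have := abs_add_le t (x - t)
    rw [add_sub_cancel] at this
    linarith
  have hm0 : m Set.univ ≠ 0 := by
    intro h0
    have h1 : (fun x => ENNReal.ofReal (g x)) =ᵐ[volume] 0 :=
      (withDensity_eq_zero_iff (by fun_prop)).1 (Measure.measure_univ_eq_zero.1 h0)
    have h2 : g =ᵐ[volume] fun _ => 0 := by
      filter_upwards [h1] with x hx
      exact le_antisymm (ENNReal.ofReal_eq_zero.1 hx) (hg0 x)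
    have h3 : g 0 = 0 := congrFun ((hgcont.ae_eq_iff_eq volume continuous_const).1 h2) 0
    -- The density is continuous and equals (∫ φ)² > 0 at the origin, so the mass is not zero and
    -- can be normalised.
    have h4 : ((𝓕 s) 0).re = ∫ x, φ x := by
      rw [SchwartzMap.fourier_coe, hscoe, Real.fourier_real_eq_integral_exp_smul]
      simp only [mul_zero, Complex.ofReal_zero, zero_mul, Complex.exp_zero, one_smul]
      rw [integral_complex_ofReal, Complex.ofReal_re]
    have h5 : 0 < ∫ x, φ x := φ.integral_pos
    have h6 : ((𝓕 s) 0).re ^ 2 = 0 := h3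
    rw [h4] at h6
    exact (pow_pos h5 2).ne' h6
  refine ⟨(m Set.univ)⁻¹ • m, ?_, fun ξ hξ => ?_⟩
  · exact ⟨by simp [ENNReal.inv_mul_cancel hm0 (measure_ne_top m _)]⟩
  · rw [fourierTransformMeasure_smul, hft, hw _ (by rwa [abs_neg]), mul_zero]

/-! ### Weights averaged over a set of dilations. -/

/-- The average over `p ∈ Q` of the dilated Fejér kernels `x ↦ fejerKernel N (p x)`. -/
noncomputable def avgFejer (Q : Finset ℕ) (N : ℕ) (x : ℝ) : ℝ :=
  (∑ p ∈ Q, fejerKernel N (p * x)) / Q.card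

lemma avgFejer_nonneg (Q : Finset ℕ) (N : ℕ) (x : ℝ) : 0 ≤ avgFejer Q N x :=
  div_nonneg (Finset.sum_nonneg fun _ _ => fejerKernel_nonneg _ _) (Nat.cast_nonneg _)

@[fun_prop]
lemma continuous_avgFejer (Q : Finset ℕ) (N : ℕ) : Continuous (avgFejer Q N) := by
  unfold avgFejer; fun_prop

lemma exists_le_of_le_avgFejer {Q : Finset ℕ} (hQ : Q.Nonempty) {N : ℕ} {x ε : ℝ}
    (h : ε ≤ avgFejer Q N x) : ∃ p ∈ Q, ε ≤ fejerKernel N (p * x) := by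
  by_contra! hlt
  have h1 := Finset.sum_lt_sum_of_nonempty hQ hlt
  have h2 : (0 : ℝ) < Q.card := by exact_mod_cast hQ.card_pos
  unfold avgFejer at h
  rw [le_div_iff₀ h2] at h
  simp at h1
  linarith

/-- The chord length is 2|sin πy|; Jordan's inequality bounds the sine from below at the
representative of y in [-1/2, 1/2]. -/
lemma four_mul_le_norm_exp_sub_one {y δ : ℝ} (h : ∀ a : ℤ, δ ≤ |y - a|) :
    4 * δ ≤ ‖Complex.exp (2 * Real.pi * Complex.I * (y : ℂ)) - 1‖ := by
  have h1 : Complex.exp (2 * Real.pi * Complex.I * (y : ℂ)) =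
      Complex.exp (Complex.I * ((2 * Real.pi * (y - round y) : ℝ) : ℂ)) := by
    rw [show (2 * Real.pi * Complex.I * (y : ℂ) : ℂ) =
      Complex.I * ((2 * Real.pi * (y - round y) : ℝ) : ℂ) + round y * (2 * Real.pi * Complex.I) by
        push_cast; ring, Complex.exp_periodic.int_mul (round y)]
  have hr := abs_sub_round y
  have h2 : 2 / Real.pi * |Real.pi * (y - round y)| ≤ |Real.sin (Real.pi * (y - round y))| := by
    refine Real.mul_abs_le_abs_sin ?_
    rw [abs_mul, abs_of_pos Real.pi_pos]
    nlinarith [Real.pi_pos]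
  rw [abs_mul, abs_of_pos Real.pi_pos] at h2
  have h3 : 2 / Real.pi * (Real.pi * |y - round y|) = 2 * |y - round y| := by
    field_simp
  rw [h1, Complex.norm_exp_I_mul_ofReal_sub_one, Real.norm_eq_abs, abs_mul, abs_two,
    show 2 * Real.pi * (y - round y) / 2 = Real.pi * (y - round y) by ring]
  linarith [h (round y)]

lemma fejerKernel_le_of_far_int {N : ℕ} (hN : 0 < N) {y δ : ℝ} (hδ : 0 < δ)
    (h : ∀ a : ℤ, δ ≤ |y - a|) : fejerKernel N y ≤ 1 / (4 * N * δ ^ 2) := by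
  have hN' : (0 : ℝ) < N := by positivity
  set z := Complex.exp (2 * Real.pi * Complex.I * (y : ℂ)) with hz
  have hsum : ∑ j ∈ Finset.range N, Complex.exp (2 * Real.pi * Complex.I * (j * y : ℝ)) =
      ∑ j ∈ Finset.range N, z ^ j := by
    refine Finset.sum_congr rfl fun j _ => ?_
    rw [hz, ← Complex.exp_nat_mul]; congr 1; push_cast; ring
  have h4 := four_mul_le_norm_exp_sub_one h
  have hgeom := congrArg norm (geom_sum_mul z N)
  rw [norm_mul] at hgeom
  have hz1 : ‖z‖ = 1 := norm_exp_two_pi_I_mul y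
  have h2 : ‖z ^ N - 1‖ ≤ 2 := by
    refine (norm_sub_le _ _).trans ?_
    rw [norm_pow, hz1]; norm_num
  have h5 : ‖∑ j ∈ Finset.range N, z ^ j‖ * (4 * δ) ≤ 2 := by
    refine le_trans ?_ (hgeom.trans_le h2)
    gcongr
  have h6 : ‖∑ j ∈ Finset.range N, z ^ j‖ ≤ 1 / (2 * δ) := by
    rw [le_div_iff₀ (by positivity)]; linarith
  unfold fejerKernel
  rw [hsum]
  calc _ ≤ (1 / (2 * δ)) ^ 2 / N := by gcongr
    _ = 1 / (4 * N * δ ^ 2) := by field_simp; norm_num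

lemma fourierTransformMeasure_avgFejer (μ : Measure ℝ) [IsFiniteMeasure μ] (Q : Finset ℕ) (N : ℕ)
    (ξ : ℝ) :
    fourierTransformMeasure (μ.withDensity fun x => ENNReal.ofReal (avgFejer Q N x)) ξ =
      (1 / Q.card : ℂ) * ∑ p ∈ Q, (1 / N : ℂ) * ∑ j ∈ Finset.range N, ∑ l ∈ Finset.range N,
        fourierTransformMeasure μ (ξ - ((j : ℝ) - (l : ℝ)) * p) := by
  rw [fourierTransformMeasure_withDensity _ (continuous_avgFejer Q N) (avgFejer_nonneg Q N)]
  simp_rw [← integral_fejerKernel_mul_exp μ N]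
  rw [← integral_finsetSum, ← integral_const_mul]
  · congr 1 with x
    rw [← Finset.sum_mul, ← mul_assoc]
    congr 1
    unfold avgFejer
    push_cast
    ring
  · intro p _
    refine (integrable_exp_fourier μ ξ).bdd_mul (c := N) ?_ (ae_of_all _ fun x => ?_)
    · exact (Complex.continuous_ofReal.comp
        ((continuous_fejerKernel N).comp (continuous_const_mul _))).aestronglyMeasurable
    · rw [Complex.norm_real, Real.norm_of_nonneg (fejerKernel_nonneg _ _)]
      exact fejerKernel_le _ _

lemma one_le_abs_natCast_sub {j l : ℕ} (h : j ≠ l) : (1 : ℝ) ≤ |(j : ℝ) - l| := by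
  have : (1 : ℤ) ≤ |(j : ℤ) - l| := Int.one_le_abs (by omega)
  exact_mod_cast this

section Step

variable {μ : Measure ℝ} {R : ℕ} {Q : Finset ℕ} {N : ℕ}

/-- Translates by a nonzero multiple of p > 2R move ξ out of [-R, R], so only the diagonal j = l
survives. -/
lemma fourierTransformMeasure_avgFejer_of_le (hμ : BandLimited μ R) (hQ : Q.Nonempty) (hN : 0 < N)
    (hQR : ∀ p ∈ Q, 2 * R < p) {ξ : ℝ} (hξ : |ξ| ≤ R) :
    fourierTransformMeasure (μ.withDensity fun x => ENNReal.ofReal (avgFejer Q N x)) ξ =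
      fourierTransformMeasure μ ξ := by
  have := hμ.prob
  rw [fourierTransformMeasure_avgFejer]
  have h1 : ∀ p ∈ Q, (1 / N : ℂ) * ∑ j ∈ Finset.range N, ∑ l ∈ Finset.range N,
      fourierTransformMeasure μ (ξ - ((j : ℝ) - (l : ℝ)) * p) = fourierTransformMeasure μ ξ := by
    intro p hp
    have h2 : ∀ j ∈ Finset.range N, ∑ l ∈ Finset.range N,
        fourierTransformMeasure μ (ξ - ((j : ℝ) - (l : ℝ)) * p) = fourierTransformMeasure μ ξ := by
      intro j hj
      rw [Finset.sum_eq_single_of_mem j hj]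
      · simp
      · intro l _ hl
        refine hμ.eq_zero _ ?_
        have h3 := one_le_abs_natCast_sub (Ne.symm hl)
        have hpR : (2 * R : ℝ) < p := by exact_mod_cast hQR p hp
        have h4 : (p : ℝ) ≤ |((j : ℝ) - l) * p| := by
          rw [abs_mul, Nat.abs_cast]
          nlinarith [Nat.cast_nonneg (α := ℝ) p]
        have h5 := abs_sub_abs_le_abs_sub (((j : ℝ) - l) * p) ξ
        rw [abs_sub_comm] at h5
        linarith
    rw [Finset.sum_congr rfl h2]
    have : (N : ℂ) ≠ 0 := by exact_mod_cast hN.ne'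
    simp
    field_simp
  rw [Finset.sum_congr rfl h1]
  have : (Q.card : ℂ) ≠ 0 := by exact_mod_cast hQ.card_pos.ne'
  simp
  field_simp

lemma fourierTransformMeasure_avgFejer_of_gt (hμ : BandLimited μ R) {P : ℕ}
    (hQP : ∀ p ∈ Q, p ≤ P) {ξ : ℝ} (hξ : R + N * P < |ξ|) :
    fourierTransformMeasure (μ.withDensity fun x => ENNReal.ofReal (avgFejer Q N x)) ξ = 0 := by
  have := hμ.prob
  rw [fourierTransformMeasure_avgFejer, Finset.sum_eq_zero, mul_zero]
  intro p hp
  rw [Finset.sum_eq_zero, mul_zero]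
  intro j hj
  refine Finset.sum_eq_zero fun l hl => hμ.eq_zero _ ?_
  have hj' : (j : ℝ) ≤ N := by exact_mod_cast (Finset.mem_range.1 hj).le
  have hl' : (l : ℝ) ≤ N := by exact_mod_cast (Finset.mem_range.1 hl).le
  have hjl : |(j : ℝ) - l| ≤ N := by
    rw [abs_le]; constructor <;> linarith [Nat.cast_nonneg (α := ℝ) j, Nat.cast_nonneg (α := ℝ) l]
  have h1 : |((j : ℝ) - l) * p| ≤ N * P := by
    rw [abs_mul, Nat.abs_cast]
    have : (p : ℝ) ≤ P := by exact_mod_cast hQP p hp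
    gcongr
  have h2 := abs_sub_abs_le_abs_sub ξ (((j : ℝ) - l) * p)
  linarith

lemma bandLimited_avgFejer (hμ : BandLimited μ R) (hQ : Q.Nonempty) (hN : 0 < N) {P : ℕ}
    (hQR : ∀ p ∈ Q, 2 * R < p) (hQP : ∀ p ∈ Q, p ≤ P) :
    BandLimited (μ.withDensity fun x => ENNReal.ofReal (avgFejer Q N x)) (R + N * P : ℕ) := by
  refine ⟨?_, fun ξ hξ => fourierTransformMeasure_avgFejer_of_gt hμ hQP (by exact_mod_cast hξ)⟩
  have := hμ.prob
  have h0 := fourierTransformMeasure_avgFejer_of_le hμ hQ hN hQR (ξ := 0) (by simp)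
  rw [fourierTransformMeasure_zero, fourierTransformMeasure_zero,
    probReal_univ (μ := μ)] at h0
  have h1 : (μ.withDensity fun x => ENNReal.ofReal (avgFejer Q N x)).real Set.univ = 1 := by
    exact_mod_cast h0
  refine ⟨?_⟩
  rw [measureReal_def, ENNReal.toReal_eq_one_iff] at h1
  exact h1

lemma card_Icc_ceil_floor_le (ξ : ℝ) (R : ℕ) :
    (Finset.Icc ⌈ξ - R⌉ ⌊ξ + R⌋).card ≤ 2 * R + 1 := by
  rw [Int.card_Icc, Int.floor_add_natCast, Int.ceil_sub_natCast]
  have := Int.floor_le_ceil ξ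
  omega

/-- A term is nonzero only if (j - l)p is a nonzero integer within R of ξ; zero is excluded by R <
|ξ|. Counting the pairs (p, k) with p ∣ k by k instead of by p gives the bound, uniformly in N. -/
lemma norm_fourierTransformMeasure_avgFejer_le (hμ : BandLimited μ R) {c : ℕ}
    (hQ0 : ∀ p ∈ Q, 0 < p) {ξ : ℝ} (hξ : R < |ξ|)
    (hc : ∀ k : ℤ, k ≠ 0 → |(k : ℝ)| ≤ |ξ| + R → (Q.filter fun p : ℕ => (p : ℤ) ∣ k).card ≤ c) :
    ‖fourierTransformMeasure (μ.withDensity fun x => ENNReal.ofReal (avgFejer Q N x)) ξ‖ ≤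
      (2 * R + 1) * c / Q.card := by
  have := hμ.prob
  rw [fourierTransformMeasure_avgFejer]
  set K : Finset ℤ := (Finset.Icc ⌈ξ - R⌉ ⌊ξ + R⌋).filter (· ≠ 0) with hK
  have memK : ∀ k : ℤ, k ∈ K ↔ |ξ - k| ≤ R ∧ k ≠ 0 := by
    intro k
    rw [hK, Finset.mem_filter, Finset.mem_Icc, Int.ceil_le, Int.le_floor, abs_le]
    constructor
    · rintro ⟨⟨h1, h2⟩, h3⟩; exact ⟨⟨by linarith, by linarith⟩, h3⟩
    · rintro ⟨⟨h1, h2⟩, h3⟩; exact ⟨⟨by linarith, by linarith⟩, h3⟩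
  have h1 : ∀ p ∈ Q, ‖(1 / N : ℂ) * ∑ j ∈ Finset.range N, ∑ l ∈ Finset.range N,
      fourierTransformMeasure μ (ξ - ((j : ℝ) - (l : ℝ)) * p)‖ ≤
      ((K.filter fun k => (p : ℤ) ∣ k).card : ℝ) := by
    intro p hp
    have h2 : ∀ j ∈ Finset.range N, ‖∑ l ∈ Finset.range N,
        fourierTransformMeasure μ (ξ - ((j : ℝ) - (l : ℝ)) * p)‖ ≤
        ((K.filter fun k => (p : ℤ) ∣ k).card : ℝ) := by
      intro j _
      calc _ ≤ ∑ l ∈ Finset.range N,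
            (if ((j : ℤ) - (l : ℤ)) * p ∈ K then (1 : ℝ) else 0) := by
            refine norm_sum_le_of_le _ fun l _ => ?_
            split_ifs with hl
            · exact norm_fourierTransformMeasure_le μ _
            · rw [memK, not_and_or, not_le, not_not] at hl
              rw [hμ.eq_zero, norm_zero]
              rcases hl with hl | hl
              · push_cast at hl; exact hl
              · have : ((j : ℝ) - l) * p = 0 := by exact_mod_cast hl
                rwa [this, sub_zero]
        _ = (((Finset.range N).filter fun l : ℕ => ((j : ℤ) - (l : ℤ)) * p ∈ K).card : ℝ) := by
            rw [Finset.sum_boole]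
        _ ≤ _ := by
            refine Nat.cast_le.2 ?_
            -- For fixed j each multiple of p is hit by at most one l, so the sum over j cancels the
            -- factor 1/N.
            refine Finset.card_le_card_of_injOn (fun l : ℕ => ((j : ℤ) - (l : ℤ)) * p) ?_ ?_
            · intro l hl
              have hl := (Finset.mem_filter.1 hl).2
              exact Finset.mem_filter.2 ⟨hl, Dvd.intro_left _ rfl⟩
            · intro l _ l' _ h
              have hp0 : (p : ℤ) ≠ 0 := by exact_mod_cast (hQ0 p hp).ne'
              have := mul_right_cancel₀ hp0 h
              omega
    rcases Nat.eq_zero_or_pos N with rfl | hN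
    · simp
    have hN' : (0 : ℝ) < N := by positivity
    rw [norm_mul]
    calc _ ≤ ‖(1 / N : ℂ)‖ * (N * ((K.filter fun k => (p : ℤ) ∣ k).card : ℝ)) := by
          gcongr
          refine (norm_sum_le_of_le _ h2).trans (by simp)
      _ = _ := by simp; field_simp
  have h3 : ∑ p ∈ Q, (K.filter fun k => (p : ℤ) ∣ k).card ≤ (2 * R + 1) * c := by
    have := Finset.sum_card_bipartiteAbove_eq_sum_card_bipartiteBelow (s := Q) (t := K)
      (fun (p : ℕ) (k : ℤ) => (p : ℤ) ∣ k)
    unfold Finset.bipartiteAbove Finset.bipartiteBelow at this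
    rw [this]
    calc _ ≤ ∑ k ∈ K, c := by
          refine Finset.sum_le_sum fun k hk => ?_
          obtain ⟨hk1, hk2⟩ := (memK k).1 hk
          refine hc k hk2 ?_
          have := abs_sub_abs_le_abs_sub (k : ℝ) ξ
          rw [abs_sub_comm] at this
          linarith
      _ = K.card * c := by simp
      _ ≤ _ := by
          gcongr
          exact (Finset.card_filter_le _ _).trans (card_Icc_ceil_floor_le ξ R)
  rw [norm_mul, norm_div, norm_one, Complex.norm_natCast, one_div_mul_eq_div]
  gcongr
  refine (norm_sum_le_of_le _ h1).trans ?_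
  exact_mod_cast h3

end Step

/-! ### Prime counting and the one-step weight. -/

lemma card_primes_dvd_le {M c : ℕ} (hM : 2 ≤ M) {Q : Finset ℕ} (hQ : ∀ p ∈ Q, p.Prime ∧ M ≤ p)
    {k : ℤ} (hk : k ≠ 0) (hkM : |(k : ℝ)| ≤ (M : ℝ) ^ c) :
    (Q.filter fun p : ℕ => (p : ℤ) ∣ k).card ≤ c := by
  set S := Q.filter fun p : ℕ => (p : ℤ) ∣ k with hS
  have h1 : ∏ p ∈ S, p ∣ k.natAbs := by
    refine Finset.prod_primes_dvd _ (fun p hp => ?_) (fun p hp => ?_)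
    · exact (hQ p (Finset.mem_filter.1 hp).1).1.prime
    · exact Int.natCast_dvd.1 (Finset.mem_filter.1 hp).2
  have h2 := Nat.le_of_dvd (Int.natAbs_pos.2 hk) h1
  have h3 : M ^ S.card ≤ ∏ p ∈ S, p :=
    Finset.pow_card_le_prod _ _ _ fun p hp => (hQ p (Finset.mem_filter.1 hp).1).2
  have h4 : k.natAbs ≤ M ^ c := by
    have : ((k.natAbs : ℕ) : ℝ) ≤ (M : ℝ) ^ c := by
      rwa [Nat.cast_natAbs, Int.cast_abs]
    exact_mod_cast this
  exact (Nat.pow_le_pow_iff_right (by omega)).1 (h3.trans (h2.trans h4))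

/-- Only M primes are wanted below M³, so Chebyshev's bound with the crude log M ≤ M suffices. -/
lemma le_card_primes_Ioc {M : ℕ} (hM : 20 ≤ M) :
    M ≤ ((Finset.Ioc M (M ^ 3)).filter Nat.Prime).card := by
  have hM' : (20 : ℝ) ≤ M := by exact_mod_cast hM
  have h1 := Chebyshev.psi_ge (M ^ 3)
  have h2 := Chebyshev.psi_le_primeCounting_mul_log (M ^ 3)
  have hlogM : Real.log M ≤ M := (Real.log_le_sub_one_of_pos (by linarith)).trans (by linarith)
  have hlog3 : Real.log ((M ^ 3 : ℕ) : ℝ) = 3 * Real.log M := by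
    push_cast; rw [Real.log_pow]; norm_num
  have hlog4 : Real.log (((M ^ 3 : ℕ) : ℝ) + 1) ≤ 4 * M := by
    have : ((M ^ 3 : ℕ) : ℝ) + 1 ≤ (M : ℝ) ^ 4 := by
      push_cast
      have : (20 : ℝ) * M ^ 3 ≤ M * M ^ 3 := by gcongr
      have : (1 : ℝ) ≤ M ^ 3 := one_le_pow₀ (by linarith)
      nlinarith
    calc _ ≤ Real.log ((M : ℝ) ^ 4) := Real.log_le_log (by positivity) this
      _ = 4 * Real.log M := by rw [Real.log_pow]; norm_num
      _ ≤ _ := by linarith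
  have h3 : 2 * M ≤ (M ^ 3).primeCounting := by
    by_contra! hlt
    have hlt' : ((M ^ 3).primeCounting : ℝ) ≤ 2 * M := by exact_mod_cast hlt.le
    rw [hlog3] at h2
    have h4 : ((M ^ 3).primeCounting : ℝ) * (3 * Real.log M) ≤ 2 * M * (3 * M) := by
      have : 0 ≤ Real.log M := Real.log_nonneg (by linarith)
      gcongr
    push_cast at h1 h2
    have h5 : (0.69 : ℝ) ≤ Real.log 2 := by linarith [Real.log_two_gt_d9]
    have h6 : (M : ℝ) ^ 3 * 0.69 ≤ M ^ 3 * Real.log 2 := by gcongr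
    have h7 : (20 : ℝ) * M ^ 2 ≤ M ^ 3 := by
      rw [pow_succ (M : ℝ) 2]; nlinarith [sq_nonneg (M : ℝ)]
    push_cast at hlog4
    nlinarith
  have h4 : (M ^ 3).primeCounting ≤ ((Finset.Ioc M (M ^ 3)).filter Nat.Prime).card + M := by
    rw [← Nat.primesLE_card_eq_primeCounting]
    have hsub : Nat.primesLE (M ^ 3) ⊆
        (Finset.Ioc M (M ^ 3)).filter Nat.Prime ∪ Finset.Ioc 0 M := by
      intro p hp
      rw [Nat.mem_primesLE] at hp
      have := hp.2.pos
      simp only [Finset.mem_union, Finset.mem_filter, Finset.mem_Ioc]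
      by_cases hpM : p ≤ M
      · right; omega
      · left; exact ⟨⟨by omega, hp.1⟩, hp.2⟩
    refine (Finset.card_le_card hsub).trans ((Finset.card_union_le _ _).trans ?_)
    simp
  omega

/-- One step of the construction: a continuous weight which preserves the low frequencies of every
band limited probability measure, creates only small higher frequencies, and is small away from
the points with a good rational approximation. -/
lemma exists_weight {f : ℝ≥0 → ℝ≥0} (hf : ∀ α : ℝ, 0 < α → ∀ᶠ ξ : ℝ≥0 in atTop, ξ ^ (-α) ≤ f ξ)
    (R n : ℕ) {ε : ℝ} (hε : 0 < ε) :
    ∃ R' : ℕ, ∃ F : ℝ → ℝ, R < R' ∧ Continuous F ∧ (∀ x, 0 ≤ F x) ∧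
      (∀ x, ε ≤ F x → ∃ a b : ℤ, 1 < b ∧ |x - a / b| < 1 / (b : ℝ) ^ n) ∧
      ∀ μ : Measure ℝ, BandLimited μ R →
        BandLimited (μ.withDensity fun x => ENNReal.ofReal (F x)) R' ∧
        (∀ ξ : ℝ, |ξ| ≤ R → fourierTransformMeasure
          (μ.withDensity fun x => ENNReal.ofReal (F x)) ξ = fourierTransformMeasure μ ξ) ∧
        ∀ ξ : ℝ, R < |ξ| → ‖fourierTransformMeasure
          (μ.withDensity fun x => ENNReal.ofReal (F x)) ξ‖ ≤ min ε (f (Real.nnabs ξ)) := by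
  -- New frequencies reach R + N M³ = R + M^(6n+4); one more power of M absorbs the shifts by R. As
  -- c depends on n alone, the hypothesis on f can be used at exponent 1/(2c) before M is chosen.
  set c : ℕ := 6 * n + 5 with hc
  have hc0 : (0 : ℝ) < c := by rw [hc]; positivity
  set α : ℝ := 1 / (2 * c) with hα
  have hα0 : 0 < α := by positivity
  obtain ⟨X, hX⟩ := eventually_atTop.1 (hf α hα0)
  obtain ⟨M, hM⟩ := exists_nat_gt (20 + 2 * R + X + 1 / ε + ((2 * R + 1) * c / ε) +
    ((2 * R + 1) * c) ^ 2 : ℝ)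
  have hX0 : (0 : ℝ) ≤ X := X.2
  have hR0 : (0 : ℝ) ≤ R := Nat.cast_nonneg R
  have e1 : 0 < 1 / ε := by positivity
  have e2 : 0 < (2 * R + 1) * c / ε := by positivity
  have e3 : 0 < ((2 * R + 1 : ℝ) * c) ^ 2 := by positivity
  have hM20 : (20 : ℝ) < M := by linarith
  have hM20' : 20 < M := by exact_mod_cast hM20
  have hM0 : (0 : ℝ) < M := by linarith
  have hMR : (2 * R : ℝ) < M := by linarith
  have hMR' : 2 * R < M := by exact_mod_cast hMR
  set Q := (Finset.Ioc M (M ^ 3)).filter Nat.Prime with hQdef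
  have hQcard : M ≤ Q.card := le_card_primes_Ioc hM20'.le
  have hQ : Q.Nonempty := Finset.card_pos.1 (by omega)
  have hQmem : ∀ p ∈ Q, (M < p ∧ p ≤ M ^ 3) ∧ p.Prime := fun p hp => by
    rw [hQdef, Finset.mem_filter, Finset.mem_Ioc] at hp; exact hp
  -- At distance δ = M^(-3n) from ℤ the kernel is at most 1/(4Nδ²) = 1/(4M) < ε, and p ≤ M³ gives δ
  -- ≤ p^(-n).
  set N := M ^ (6 * n + 1) with hNdef
  have hN : 0 < N := pow_pos (by omega) _
  have hRR : R < R + N * M ^ 3 := by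
    have : 0 < N * M ^ 3 := Nat.mul_pos hN (pow_pos (by omega) _)
    omega
  refine ⟨R + N * M ^ 3, avgFejer Q N, hRR, continuous_avgFejer Q N,
    avgFejer_nonneg Q N, fun x hx => ?_, fun μ hμ => ⟨?_, ?_, fun ξ hξ => ?_⟩⟩
  · obtain ⟨p, hp, hpx⟩ := exists_le_of_le_avgFejer hQ hx
    obtain ⟨⟨hMp, hpM⟩, hprime⟩ := hQmem p hp
    have hp1 : (1 : ℝ) ≤ p := by exact_mod_cast hprime.one_le
    have hpM' : (p : ℝ) ≤ M ^ 3 := by exact_mod_cast hpM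
    have hex : ∃ a : ℤ, |p * x - a| < 1 / (M : ℝ) ^ (3 * n) := by
      by_contra! hfar
      have h1 := hpx.trans (fejerKernel_le_of_far_int hN (by positivity) hfar)
      have h2 : 1 / (4 * (N : ℝ) * (1 / (M : ℝ) ^ (3 * n)) ^ 2) = 1 / (4 * M) := by
        rw [hNdef]; push_cast
        rw [show 6 * n + 1 = 3 * n + 3 * n + 1 by ring, pow_succ, pow_add]
        field_simp
      have h3 : 1 / (4 * (M : ℝ)) < ε := by
        rw [div_lt_iff₀ (by positivity)]
        have : 1 / ε < M := by linarith
        rw [div_lt_iff₀ hε] at this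
        linarith
      linarith
    obtain ⟨a, ha⟩ := hex
    refine ⟨a, p, by exact_mod_cast hprime.one_lt, ?_⟩
    push_cast
    have h1 : x - a / p = (p * x - a) / p := by field_simp
    rw [h1, abs_div, Nat.abs_cast]
    calc _ ≤ |p * x - a| := div_le_self (abs_nonneg _) hp1
      _ < 1 / (M : ℝ) ^ (3 * n) := ha
      _ ≤ 1 / (p : ℝ) ^ n := by
          rw [pow_mul]
          gcongr
  · exact bandLimited_avgFejer hμ hQ hN (fun p hp => hMR'.trans (hQmem p hp).1.1)
      fun p hp => (hQmem p hp).1.2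
  · exact fun ξ hξ => fourierTransformMeasure_avgFejer_of_le hμ hQ hN
      (fun p hp => hMR'.trans (hQmem p hp).1.1) hξ
  · have hQpos : ∀ p ∈ Q, 0 < p := fun p hp => (hQmem p hp).2.pos
    have hQprime : ∀ p ∈ Q, p.Prime ∧ M + 1 ≤ p := fun p hp => ⟨(hQmem p hp).2, (hQmem p hp).1.1⟩
    by_cases hbig : R + N * (M ^ 3 : ℕ) < |ξ|
    · rw [fourierTransformMeasure_avgFejer_of_gt hμ (fun p hp => (hQmem p hp).1.2) hbig, norm_zero]
      exact le_min hε.le (NNReal.coe_nonneg _)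
    push Not at hbig
    -- No prime above M divides a nonzero integer of size at most M, so the transform vanishes here.
    -- In the other case |ξ| > M - R, which is large enough to use the bound on f.
    by_cases hsmall : |ξ| + R ≤ M
    · have h0 := norm_fourierTransformMeasure_avgFejer_le (N := N) (c := 0) hμ hQpos hξ
        fun k hk hkξ => by
          rw [Nat.le_zero, Finset.card_eq_zero, Finset.filter_eq_empty_iff]
          intro p hp hpk
          have h1 : (p : ℤ) ≤ |k| := Int.le_of_dvd (abs_pos.2 hk) ((dvd_abs _ _).2 hpk)
          have h2 : (p : ℝ) ≤ |(k : ℝ)| := by exact_mod_cast h1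
          have h3 : (M : ℝ) < p := by exact_mod_cast (hQmem p hp).1.1
          linarith
      simp only [CharP.cast_eq_zero, mul_zero, zero_div] at h0
      exact h0.trans (le_min hε.le (NNReal.coe_nonneg _))
    push Not at hsmall
    have hpow : (N : ℝ) * (M ^ 3 : ℕ) = (M : ℝ) ^ (6 * n + 4) := by
      rw [hNdef]; push_cast; ring
    have hMpow : (M : ℝ) ≤ M ^ (6 * n + 4) := le_self_pow₀ (by linarith) (by omega)
    have hcpow : (2 : ℝ) * M ^ (6 * n + 4) ≤ M ^ c := by
      rw [hc, show 6 * n + 5 = (6 * n + 4) + 1 by ring, pow_succ (M : ℝ) (6 * n + 4), mul_comm]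
      gcongr
      linarith
    rw [hpow] at hbig
    have hξc : |ξ| + R ≤ (M : ℝ) ^ c := by linarith
    have hMc : (M : ℝ) ^ c ≤ ((M + 1 : ℕ) : ℝ) ^ c := by
      push_cast; gcongr; linarith
    have hb := norm_fourierTransformMeasure_avgFejer_le (N := N) (c := c) hμ hQpos hξ
      fun k hk hkξ => card_primes_dvd_le (by omega) hQprime hk
        ((hkξ.trans hξc).trans hMc)
    have hQM : (M : ℝ) ≤ Q.card := by exact_mod_cast hQcard
    have hb' : ‖fourierTransformMeasure (μ.withDensity fun x => ENNReal.ofReal (avgFejer Q N x)) ξ‖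
        ≤ (2 * R + 1) * c / M := hb.trans (by gcongr)
    refine hb'.trans (le_min ?_ ?_)
    · rw [div_le_iff₀ hM0]
      have : (2 * R + 1) * c / ε < M := by linarith
      rw [div_lt_iff₀ hε] at this
      linarith
    · have hXξ : X ≤ Real.nnabs ξ := by
        rw [← NNReal.coe_le_coe, Real.coe_nnabs]; linarith
      have h1 : |ξ| ^ (-α) ≤ f (Real.nnabs ξ) := by
        have := NNReal.coe_le_coe.2 (hX _ hXξ)
        push_cast at this
        simpa using this
      refine le_trans ?_ h1
      have hξ0 : 0 < |ξ| := hR0.trans_lt hξ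
      have h2 : ((M : ℝ) ^ c) ^ (-α) ≤ |ξ| ^ (-α) :=
        Real.rpow_le_rpow_of_nonpos hξ0 (by linarith) (by linarith)
      refine le_trans ?_ h2
      have h3 : ((M : ℝ) ^ c) ^ (-α) = 1 / √M := by
        rw [← Real.rpow_natCast, ← Real.rpow_mul hM0.le, Real.sqrt_eq_rpow, one_div,
          ← Real.rpow_neg hM0.le]
        congr 1
        rw [hα]; field_simp
      -- Half of the gain 1/M absorbs the constant (2R + 1)c; the remaining M^(-1/2) equals
      -- (M^c)^(-α).
      have h4 : (2 * R + 1) * c ≤ √(M : ℝ) := Real.le_sqrt_of_sq_le (by linarith)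
      rw [h3]
      calc (2 * R + 1) * c / (M : ℝ) ≤ √M / M := by gcongr
        _ = 1 / √M := Real.sqrt_div_self'

/-! ### Weak limits of measures with stabilising transforms. -/

lemma fourierTransformMeasure_eq_charFun (μ : Measure ℝ) (ξ : ℝ) :
    fourierTransformMeasure μ ξ = charFun μ (-2 * Real.pi * ξ) := by
  rw [charFun_apply_real]
  unfold fourierTransformMeasure
  congr 1 with x
  congr 1
  push_cast; ring

lemma charFun_eq_fourierTransformMeasure (μ : Measure ℝ) (t : ℝ) :
    charFun μ t = fourierTransformMeasure μ (-t / (2 * Real.pi)) := by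
  rw [fourierTransformMeasure_eq_charFun]
  congr 1
  field_simp

/-- If the Fourier transforms of a sequence of probability measures stabilise on larger and larger
intervals, then the sequence has a weak cluster point whose Fourier transform is the limit. -/
lemma exists_weak_limit (μ : ℕ → Measure ℝ) (hμ : ∀ i, IsProbabilityMeasure (μ i)) (R : ℕ → ℕ)
    (hR : ∀ i, i ≤ R i)
    (h : ∀ i k, i ≤ k → ∀ ξ : ℝ, |ξ| ≤ R i →
      fourierTransformMeasure (μ k) ξ = fourierTransformMeasure (μ i) ξ) :
    ∃ ν : Measure ℝ, IsProbabilityMeasure ν ∧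
      (∀ i, ∀ ξ : ℝ, |ξ| ≤ R i → fourierTransformMeasure ν ξ = fourierTransformMeasure (μ i) ξ) ∧
      ∀ (G : Set ℝ) (c : ℝ≥0∞), IsOpen G → (∀ᶠ i in atTop, μ i G ≤ c) → ν G ≤ c := by
  have hstab : ∀ (t : ℝ) (k : ℕ), ⌈|t|⌉₊ ≤ k → charFun (μ k) t = charFun (μ ⌈|t|⌉₊) t := by
    intro t k hk
    rw [charFun_eq_fourierTransformMeasure, charFun_eq_fourierTransformMeasure]
    refine h _ _ hk _ ?_
    have h1 : |-t / (2 * Real.pi)| ≤ |t| := by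
      rw [abs_div, abs_neg, abs_of_pos (by positivity : 0 < 2 * Real.pi)]
      exact div_le_self (abs_nonneg _) (by linarith [Real.pi_gt_three])
    have h2 : ((⌈|t|⌉₊ : ℕ) : ℝ) ≤ R ⌈|t|⌉₊ := by exact_mod_cast hR _
    exact h1.trans ((Nat.le_ceil _).trans h2)
  have hcont : ContinuousAt (fun t : ℝ => charFun (μ ⌈|t|⌉₊) t) 0 := by
    -- On |t| < 1 the limit is the characteristic function of `μ 1`, so it is continuous at 0, which
    -- yields tightness.
    have h1 : ContinuousAt (fun t : ℝ => charFun (μ 1) t) 0 := by fun_prop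
    refine h1.congr ?_
    filter_upwards [Metric.ball_mem_nhds (0 : ℝ) one_pos] with t ht
    rw [mem_ball_zero_iff, Real.norm_eq_abs] at ht
    exact hstab t 1 (Nat.ceil_le.2 (by push_cast; exact ht.le))
  have htight := isTightMeasureSet_of_tendsto_charFun hcont
    fun t => tendsto_const_nhds.congr' ((eventually_ge_atTop ⌈|t|⌉₊).mono fun k hk =>
      (hstab t k hk).symm)
  let P : ℕ → ProbabilityMeasure ℝ := fun i => ⟨μ i, hμ i⟩
  have hcomp : IsCompact (closure (Set.range P)) := by
    refine isCompact_closure_of_isTightMeasureSet (htight.subset ?_)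
    rintro _ ⟨_, ⟨i, rfl⟩, rfl⟩
    exact ⟨i, rfl⟩
  -- A limit along an ultrafilter avoids extracting a subsequence.
  obtain ⟨ν, -, hν⟩ := hcomp.ultrafilter_le_nhds ((hyperfilter ℕ).map P)
    (by
      rw [Filter.le_principal_iff]
      exact Filter.mem_map.2 (univ_mem' fun i => subset_closure ⟨i, rfl⟩))
  have hν : Tendsto P (hyperfilter ℕ) (nhds ν) := hν
  have hU : (hyperfilter ℕ : Filter ℕ) ≤ atTop := by
    rw [← Nat.cofinite_eq_atTop]; exact hyperfilter_le_cofinite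
  refine ⟨ν, inferInstance, fun i ξ hξ => ?_, fun G c hG hc => ?_⟩
  · have h1 : Tendsto (fun k => charFun (μ k) (-2 * Real.pi * ξ)) (hyperfilter ℕ)
        (nhds (charFun (ν : Measure ℝ) (-2 * Real.pi * ξ))) := by
      rw [ProbabilityMeasure.tendsto_iff_forall_integral_rclike_tendsto ℂ] at hν
      simp_rw [charFun_eq_integral_innerProbChar]
      exact hν _
    rw [← fourierTransformMeasure_eq_charFun] at h1
    refine tendsto_nhds_unique h1 (tendsto_const_nhds.congr' ?_)
    filter_upwards [hU (eventually_ge_atTop i)] with k hk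
    rw [← fourierTransformMeasure_eq_charFun, h i k hk ξ hξ]
  · refine (ProbabilityMeasure.le_liminf_measure_open_of_tendsto hν hG).trans ?_
    exact liminf_le_of_le (by isBoundedDefault) fun b hb => by
      obtain ⟨k, hk1, hk2⟩ := (hb.and (hU hc)).exists
      exact hk1.trans hk2

/-! ### The iterated construction and part (i). -/

lemma withDensity_mono_left {α : Type*} [MeasurableSpace α] {μ ν : Measure α} (h : μ ≤ ν)
    (g : α → ℝ≥0∞) : μ.withDensity g ≤ ν.withDensity g := by
  refine Measure.le_iff.2 fun s hs => ?_
  rw [withDensity_apply _ hs, withDensity_apply _ hs]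
  exact lintegral_mono' (Measure.restrict_mono le_rfl h) le_rfl

lemma mem_fourierSet_of_eventually_rpow_le {f : ℝ≥0 → ℝ≥0}
    (hf : ∀ α : ℝ, 0 < α → ∀ᶠ ξ : ℝ≥0 in atTop, ξ ^ (-α) ≤ f ξ) : f ∈ fourierSet liouvilleSet := by
  choose R' F hRR' hFcont hF0 hFgood hFstep using
    fun R n : ℕ => exists_weight hf R n (ε := (1 / 2) ^ n) (by positivity)
  obtain ⟨μ₀, hμ₀⟩ := exists_bandLimited
  obtain ⟨R, hR0, hRsucc⟩ : ∃ R : ℕ → ℕ, R 0 = 1 ∧ ∀ i, R (i + 1) = R' (R i) i :=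
    ⟨fun i => Nat.rec 1 (fun i r => R' r i) i, rfl, fun _ => rfl⟩
  obtain ⟨μ, hμ0, hμsucc⟩ : ∃ μ : ℕ → Measure ℝ, μ 0 = μ₀ ∧
      ∀ i, μ (i + 1) = (μ i).withDensity fun x => ENNReal.ofReal (F (R i) i x) :=
    ⟨fun i => Nat.rec μ₀ (fun i m => m.withDensity fun x => ENNReal.ofReal (F (R i) i x)) i,
      rfl, fun _ => rfl⟩
  have hRmono : StrictMono R := strictMono_nat_of_lt_succ fun i => by
    rw [hRsucc]; exact hRR' _ _
  have hband : ∀ i, BandLimited (μ i) (R i) := by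
    intro i
    induction i with
    | zero => rw [hμ0, hR0]; simpa using hμ₀
    | succ i ih => rw [hμsucc, hRsucc]; exact (hFstep _ _ _ ih).1
  have hprob : ∀ i, IsProbabilityMeasure (μ i) := fun i => (hband i).prob
  have hstab : ∀ i k, i ≤ k → ∀ ξ : ℝ, |ξ| ≤ R i →
      fourierTransformMeasure (μ k) ξ = fourierTransformMeasure (μ i) ξ := by
    intro i k hik ξ hξ
    induction k, hik using Nat.le_induction with
    | base => rfl
    | succ k hk ih =>
      rw [← ih, hμsucc]
      refine (hFstep _ _ _ (hband k)).2.1 ξ (hξ.trans ?_)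
      exact_mod_cast hRmono.monotone hk
  obtain ⟨ν, hν, hνft, hνopen⟩ := exists_weak_limit μ hprob R (fun _ => hRmono.le_apply) hstab
  have hbound : ∀ (i : ℕ) (ξ : ℝ), R i < |ξ| →
      ∃ j, i ≤ j ∧ ‖fourierTransformMeasure ν ξ‖ ≤ min ((1 / 2) ^ j) (f (Real.nnabs ξ)) := by
    intro i ξ hξ
    -- At the first stage k with |ξ| ≤ R k the frequency ξ is frozen, and it was still new for the
    -- weight of stage k - 1, which provides the bound.
    have hex : ∃ k, |ξ| ≤ R k := ⟨⌈|ξ|⌉₊, (Nat.le_ceil _).trans (by exact_mod_cast hRmono.le_apply)⟩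
    classical
    obtain ⟨k, hk, hkmin⟩ : ∃ k, |ξ| ≤ R k ∧ ∀ m < k, R m < |ξ| :=
      ⟨Nat.find hex, Nat.find_spec hex, fun m hm => not_le.1 (Nat.find_min hex hm)⟩
    have hik : i < k := by
      by_contra! hki
      have : (R k : ℝ) ≤ R i := by exact_mod_cast hRmono.monotone hki
      linarith
    obtain ⟨j, rfl⟩ : ∃ j, k = j + 1 := ⟨k - 1, by omega⟩
    refine ⟨j, by omega, ?_⟩
    rw [hνft _ ξ hk, hμsucc]
    exact (hFstep _ _ _ (hband j)).2.2 ξ (hkmin j (by omega))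
  let A : ℕ → Set ℝ := fun j => {x | F (R j) j x < (1 / 2) ^ j}
  have hAopen : ∀ j, IsOpen (A j) := fun j => isOpen_lt (hFcont _ _) continuous_const
  -- The restriction to `A j` is not band-limited itself, so the induction carries a band-limited
  -- probability measure dominating it up to the factor 2^(-j). Later weights apply to both sides
  -- and keep the dominating one a probability measure.
  have hrestrict : ∀ j i, j + 1 ≤ i → ∃ m : Measure ℝ, BandLimited m (R i) ∧
      (μ i).restrict (A j) ≤ ENNReal.ofReal ((1 / 2) ^ j) • m := by
    intro j i hi
    induction i, hi using Nat.le_induction with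
    | base =>
      refine ⟨μ j, ⟨hprob j, fun ξ hξ => (hband j).eq_zero ξ (lt_trans ?_ hξ)⟩, ?_⟩
      · exact_mod_cast hRmono (Nat.lt_succ_self j)
      · rw [hμsucc, restrict_withDensity (hAopen j).measurableSet]
        refine (withDensity_mono (g := fun _ => ENNReal.ofReal ((1 / 2) ^ j)) ?_).trans ?_
        · filter_upwards [ae_restrict_mem (hAopen j).measurableSet] with x hx
          exact ENNReal.ofReal_le_ofReal (le_of_lt hx)
        · rw [withDensity_const]
          gcongr
          exact Measure.restrict_le_self
    | succ i hi ih =>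
      obtain ⟨m, hm, hle⟩ := ih
      refine ⟨m.withDensity fun x => ENNReal.ofReal (F (R i) i x), ?_, ?_⟩
      · rw [hRsucc]; exact (hFstep _ _ _ hm).1
      · rw [hμsucc, restrict_withDensity (hAopen j).measurableSet, ← withDensity_smul_measure]
        exact withDensity_mono_left hle _
  have hAν : ∀ j, ν (A j) ≤ ENNReal.ofReal ((1 / 2) ^ j) := by
    intro j
    refine hνopen _ _ (hAopen j) ((eventually_ge_atTop (j + 1)).mono fun i hi => ?_)
    obtain ⟨m, hm, hle⟩ := hrestrict j i hi
    have := hm.prob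
    calc μ i (A j) = (μ i).restrict (A j) Set.univ := by simp
      _ ≤ (ENNReal.ofReal ((1 / 2) ^ j) • m) Set.univ := hle _
      _ = _ := by simp
  have hsum : ∑' j, ν (A j) ≠ ∞ :=
    ne_top_of_le_ne_top summable_geometric_two.tsum_ofReal_ne_top (ENNReal.tsum_le_tsum hAν)
  have hrat : ν (Set.range ((↑) : ℚ → ℝ)) = 0 := by
    rw [← Set.iUnion_singleton_eq_range]
    refine measure_iUnion_null fun r => measure_singleton_eq_zero_of_rational ν (fun ε hε => ?_) r
    -- The bound 2^(-j) makes ν̂ tend to 0 even when f does not.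
    obtain ⟨i, hi⟩ := exists_pow_lt_of_lt_one hε (by norm_num : (1 / 2 : ℝ) < 1)
    refine ⟨R i + 1, fun ξ hξ => ?_⟩
    obtain ⟨j, hij, hj⟩ := hbound i ξ (by linarith)
    refine (hj.trans (min_le_left _ _)).trans (le_trans ?_ hi.le)
    exact pow_le_pow_of_le_one (by norm_num) (by norm_num) hij
  refine ⟨ν, hν, ?_, R 0 + 1, by positivity, 1, one_pos, fun ξ hξ => ?_⟩
  · have hae : ∀ᵐ x ∂ν, x ∈ liouvilleSet := by
      have hirr : ∀ᵐ x ∂ν, x ∉ Set.range ((↑) : ℚ → ℝ) := measure_eq_zero_iff_ae_notMem.1 hrat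
      filter_upwards [ae_eventually_notMem hsum, hirr] with x hx hxirr n
      obtain ⟨j, hj, hnj⟩ := (hx.and (eventually_ge_atTop n)).exists
      obtain ⟨a, b, hb, hab⟩ := hFgood (R j) j x (not_lt.1 hj)
      refine ⟨a, b, hb, ?_, hab.trans_le ?_⟩
      -- `Liouville` demands x ≠ a / b, which is why the rationals had to be shown null.
      · rintro rfl
        exact hxirr ⟨(a / b : ℚ), by push_cast; rfl⟩
      · have hb1 : (1 : ℝ) ≤ b := by exact_mod_cast hb.le
        gcongr
    exact hae
  · obtain ⟨j, -, hj⟩ := hbound 0 ξ (by linarith)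
    rw [one_mul]
    exact hj.trans (min_le_right _ _)

theorem mainTheorem1 (f : ℝ≥0 → ℝ≥0) (hbdd : BddAbove (Set.range f))
    (hf : Antitone f ∨ Continuous f) :
    ((∀ α : ℝ, 0 < α → limsup (powerRatio f α) atTop = 0) → f ∈ fourierSet liouvilleSet) ∧
    ((∃ α₀ : ℝ, 0 < α₀ ∧ 0 < liminf (powerRatio f α₀) atTop) →
      f ∉ fourierSet liouvilleSet) :=
  ⟨fun h => mem_fourierSet_of_eventually_rpow_le fun α hα =>
      eventually_rpow_le_of_limsup_eq_zero (h α hα),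
    fun ⟨_, hα, h⟩ => not_mem_fourierSet_of_liminf_pos hα h⟩
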